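/- Let $(N,h)$ be a smooth Riemannian manifold of dimension $n\ge 1$ with Levi-Civita connection $\nabla$ and Riemann curvature tensor $R$, and let $\gamma:\mathbb{R}\to N$ be a (complete) geodesic parametrized by arc length. Suppose that $N$ is locally symmetric along $\gamma$, i.e. $\nabla_{\dot\gamma}\nabla^jR=0$ at every point of $\gamma$ for all $j=0,1,2,\dots$. Let $e_1=\dot\gamma$ and let $e_2,\dots,e_n$ be parallel vector fields along $\gamma$ such that $(e_1,\dots,e_n)$ is orthonormal at $\gamma(0)$ (hence everywhere along $\gamma$). Let $(x^1,\dots,x^n)$ be the geodesic normal (Fermi) coordinates around $\gamma$ given by the parametrization $$\sigma(x^1,x^2,\dots,x^n)=\exp_{\gamma(x^1)}\Big(\sum_{j=2}^n x^je_j(x^1)\Big),$$ considered on an open neighborhood $U\subset\mathbb{R}^n$ of the axis $\mathbb{R}\times\{0\}$ which is star-shaped in the transversal variables $(x^2,\dots,x^n)$ and on which $\sigma$ is defined and is a local diffeomorphism. Let $g_{ij}=h(\partial_i\sigma,\partial_j\sigma)$ be the components of the metric on $U$, let $\Gamma^k_{ij}$ be the Christoffel symbols of $g$, and let $R^i_{jkl}$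 be the components of the curvature, with $\nabla_j\nabla_k\partial_l-\nabla_k\nabla_j\partial_l=R^i_{jkl}\partial_i$. Then $\Gamma^k_{ij}$ and $R^i_{jkl}$ are smooth on $U$, and for every multi-index $I=(i_1,\dots,i_m)\in\{1,\dots,n\}^m$, $m\ge 0$, with $\partial^I=\partial_{i_1}\cdots\partial_{i_m}$, and for all indices $i,j,k,l\in\{1,\dots,n\}$, $$\partial_1\partial^I\Gamma^k_{ij}(x^1,0,\dots,0)=0,\qquad \partial_1\partial^IR^i_{jkl}(x^1,0,\dots,0)=0\qquad\text{for all }x^1\in\mathbb{R}.$$ Hence all Taylor coefficients of the Christoffel symbols and of the curvature components along $\gamma$ are constant: $\partial^I\Gamma^k_{ij}(x^1,0,\dots,0)$ and $\partial^IR^i_{jkl}(x^1,0,\dots,0)$ do not depend on $x^1$. -/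

import Mathlib

open scoped Manifold ContDiff

noncomputable section

namespace FermiCoord

/-- The coordinate space `ℝ^{d+1}`. The index `0` plays the role of the tangential direction
(`x^1` in classical notation), the indices `j.succ` are the transversal directions. -/
abbrev Coord (d : ℕ) : Type := EuclideanSpace ℝ (Fin (d + 1))

/-- The `i`-th standard basis vector of the coordinate space. -/
def basisVec {d : ℕ} (i : Fin (d + 1)) : Coord d := EuclideanSpace.single i (1 : ℝ)

/-- The partial derivative `∂_i f`. -/
def pd {d : ℕ} (i : Fin (d + 1)) (f : Coord d → ℝ) (x : Coord d) : ℝ :=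
  fderiv ℝ f x (basisVec i)

/-- The iterated partial derivative `∂^I f = ∂_{i_1} ∂_{i_2} ⋯ ∂_{i_m} f` for
`I = (i_1, …, i_m)`. -/
def pdIter {d : ℕ} : List (Fin (d + 1)) → (Coord d → ℝ) → Coord d → ℝ
  | [], f => f
  | i :: I, f => pd i (pdIter I f)

/-! ### Local tensor calculus

Here `g` is a field of matrices of metric components `g_{ij}` in some coordinates. -/

/-- Christoffel symbols:
`Γ^k_{ij} = 1/2 * g^{kl} (∂_i g_{jl} + ∂_j g_{il} - ∂_l g_{ij})`. -/
def christoffel {d : ℕ} (g : Coord d → Matrix (Fin (d + 1)) (Fin (d + 1)) ℝ)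
    (k i j : Fin (d + 1)) (x : Coord d) : ℝ :=
  (1 / 2 : ℝ) * ∑ l, (g x)⁻¹ k l *
    (pd i (fun y => g y j l) x + pd j (fun y => g y i l) x - pd l (fun y => g y i j) x)

/-- Components of the Riemann curvature tensor, with the convention
`∇_j ∇_k ∂_l - ∇_k ∇_j ∂_l = R^i_{jkl} ∂_i`. -/
def riemann {d : ℕ} (g : Coord d → Matrix (Fin (d + 1)) (Fin (d + 1)) ℝ)
    (i j k l : Fin (d + 1)) (x : Coord d) : ℝ :=
  pd j (christoffel g i k l) x - pd k (christoffel g i j l) x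
    + ∑ m, (christoffel g i j m x * christoffel g m k l x
        - christoffel g i k m x * christoffel g m j l x)

/-- Components `T^i_{J_1 … J_m}` of a tensor field of type `(1, m)` in some coordinates. -/
abbrev TensorComp (d m : ℕ) : Type :=
  Fin (d + 1) → (Fin m → Fin (d + 1)) → Coord d → ℝ

/-- Covariant derivative of a tensor field of type `(1, m)`; the index of differentiation is the
first lower index of the result:
`(∇_k T)^i_J = ∂_k T^i_J + Γ^i_{ka} T^a_J - ∑_p Γ^a_{k J_p} T^i_{J_1 … a … J_m}`. -/
def covDeriv {d m : ℕ} (g : Coord d → Matrix (Fin (d + 1)) (Fin (d + 1)) ℝ)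
    (T : TensorComp d m) : TensorComp d (m + 1) := fun i J x =>
  pd (J 0) (T i (Fin.tail J)) x
    + ∑ a, christoffel g i (J 0) a x * T a (Fin.tail J) x
    - ∑ p : Fin m, ∑ a, christoffel g a (J 0) (Fin.tail J p) x *
        T i (Function.update (Fin.tail J) p a) x

/-- Components of `∇^j R`, the `j`-th iterated covariant derivative of the curvature tensor. -/
def iterCovRiemann {d : ℕ} (g : Coord d → Matrix (Fin (d + 1)) (Fin (d + 1)) ℝ) :
    (j : ℕ) → TensorComp d (3 + j)
  | 0 => fun i J x => riemann g i (J 0) (J 1) (J 2) x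
  | j + 1 => covDeriv g (iterCovRiemann g j)

/-! ### Riemannian manifolds -/

section Manifold

variable {d : ℕ} {N : Type*} [TopologicalSpace N] [ChartedSpace (Coord d) N]
  [IsManifold (𝓡 (d + 1)) ∞ N]

/-- A smooth Riemannian metric on the `(d+1)`-dimensional manifold `N`. -/
abbrev Metric (d : ℕ) (N : Type*) [TopologicalSpace N] [ChartedSpace (Coord d) N]
    [IsManifold (𝓡 (d + 1)) ∞ N] : Type _ :=
  Bundle.ContMDiffRiemannianMetric (𝓡 (d + 1)) ∞ (Coord d)
    (fun p : N => TangentSpace (𝓡 (d + 1)) p)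

/-- The metric components `g_{ij} = h(∂_i ψ, ∂_j ψ)` in a local parametrization `ψ` of `N`. -/
def metricComp (h : Metric d N) (ψ : Coord d → N) (x : Coord d) :
    Matrix (Fin (d + 1)) (Fin (d + 1)) ℝ := Matrix.of fun i j =>
  h.inner (ψ x) (mfderiv (𝓡 (d + 1)) (𝓡 (d + 1)) ψ x (basisVec i))
    (mfderiv (𝓡 (d + 1)) (𝓡 (d + 1)) ψ x (basisVec j))

/-- The velocity vector of a curve. -/
def velocity (c : ℝ → N) (t : ℝ) : TangentSpace (𝓡 (d + 1)) (c t) :=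
  mfderiv 𝓘(ℝ, ℝ) (𝓡 (d + 1)) c t (1 : ℝ)

/-- `c` is a geodesic on the open set `S` of parameters: it is smooth there, and it solves the
geodesic equation `u'' ^ i + Γ^i_{jk} u' ^ j u' ^ k = 0` in every chart of `N`. -/
def IsGeodesicOn (h : Metric d N) (c : ℝ → N) (S : Set ℝ) : Prop :=
  ContMDiffOn 𝓘(ℝ, ℝ) (𝓡 (d + 1)) ∞ c S ∧
  ∀ φ ∈ IsManifold.maximalAtlas (𝓡 (d + 1)) ∞ N, ∀ t ∈ S, c t ∈ φ.source → ∀ i,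
    deriv (deriv fun s => φ (c s) i) t
      + ∑ j, ∑ k, christoffel (metricComp h φ.symm) i j k (φ (c t))
          * deriv (fun s => φ (c s) j) t * deriv (fun s => φ (c s) k) t = 0

/-- The vector field `V` along the curve `c : ℝ → N` is parallel:
`(V^i)' + Γ^i_{jk} u' ^ j V^k = 0` in every chart of `N`. -/
def IsParallelAlong (h : Metric d N) (c : ℝ → N)
    (V : (t : ℝ) → TangentSpace (𝓡 (d + 1)) (c t)) : Prop :=
  ∀ φ ∈ IsManifold.maximalAtlas (𝓡 (d + 1)) ∞ N, ∀ t, c t ∈ φ.source →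
    let v : ℝ → Coord d := fun s => mfderiv (𝓡 (d + 1)) (𝓡 (d + 1)) φ (c s) (V s)
    ∀ i, HasDerivAt (fun s => v s i)
      (-∑ j, ∑ k, christoffel (metricComp h φ.symm) i j k (φ (c t))
          * deriv (fun s => φ (c s) j) t * v t k) t

/-- `N` is locally symmetric along `γ`: `∇_{γ'} ∇^j R = 0` at every point of `γ`, for all
`j = 0, 1, 2, …`; the vanishing of this tensor is expressed by its components in the charts. -/
def IsLocallySymmetricAlong (h : Metric d N) (γ : ℝ → N) : Prop :=
  ∀ j : ℕ, ∀ t : ℝ, ∀ φ ∈ IsManifold.maximalAtlas (𝓡 (d + 1)) ∞ N, γ t ∈ φ.source →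
    ∀ (i : Fin (d + 1)) (J : Fin (3 + j) → Fin (d + 1)),
      ∑ k, deriv (fun s => φ (γ s) k) t *
        covDeriv (metricComp h φ.symm) (iterCovRiemann (metricComp h φ.symm) j) i
          (Fin.cons k J) (φ (γ t)) = 0

/-- A frame along `γ` consisting of `e_0 = γ'` and of vector fields `e_1, …, e_d` obtained by
parallel transport, which is orthonormal at `γ(0)`. (In particular `γ` has unit speed there.) -/
structure IsFermiFrame (h : Metric d N) (γ : ℝ → N)
    (e : Fin (d + 1) → (t : ℝ) → TangentSpace (𝓡 (d + 1)) (γ t)) : Prop where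
  tangent : ∀ t, e 0 t = velocity γ t
  parallel : ∀ j : Fin d, IsParallelAlong h γ (e j.succ)
  orthonormal : ∀ i j, h.inner (γ 0) (e i 0) (e j 0) = if i = j then 1 else 0

/-- The point `(t, 0, …, 0)` of the axis, which corresponds to `γ(t)`. -/
def axis {d : ℕ} (t : ℝ) : Coord d := EuclideanSpace.single 0 t

/-- The point `(0, y)` of the coordinate space. -/
def transversal {d : ℕ} (y : Fin d → ℝ) : Coord d :=
  WithLp.toLp 2 (Fin.cons (0 : ℝ) y : Fin (d + 1) → ℝ)

/-- Geodesic normal (Fermi) coordinates around `γ`, given by the parametrization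
`σ(t, y) = exp_{γ(t)} (∑ j, y_j e_j(t))` of a neighborhood of `γ`. The domain `U` is an open
neighborhood of the axis, star-shaped in the transversal directions; `σ` is a local
diffeomorphism on it (it need not be injective, as `γ` may be closed); and for all `t` and `y` the
curve `s ↦ σ(t, s y)` is the geodesic which starts from `γ(t)` with velocity `∑ j, y_j e_j(t)`. -/
structure IsFermiCoordinates (h : Metric d N) (γ : ℝ → N)
    (e : Fin (d + 1) → (t : ℝ) → TangentSpace (𝓡 (d + 1)) (γ t))
    (U : Set (Coord d)) (σ : Coord d → N) : Prop where
  isOpen : IsOpen U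
  axis_mem : ∀ t, axis t ∈ U
  starShaped : ∀ (t : ℝ) (y : Fin d → ℝ), axis t + transversal y ∈ U →
    ∀ s ∈ Set.Icc (0 : ℝ) 1, axis t + s • transversal y ∈ U
  isLocalDiffeomorphOn : IsLocalDiffeomorphOn (𝓡 (d + 1)) (𝓡 (d + 1)) ∞ σ U
  geodesic : ∀ (t : ℝ) (y : Fin d → ℝ),
    IsGeodesicOn h (fun s : ℝ => σ (axis t + s • transversal y))
      {s : ℝ | axis t + s • transversal y ∈ U}
  initial : ∀ (t : ℝ) (y : Fin d → ℝ),
    (⟨σ (axis t + (0 : ℝ) • transversal y),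
        velocity (fun s : ℝ => σ (axis t + s • transversal y)) 0⟩ :
      TangentBundle (𝓡 (d + 1)) N)
    = ⟨γ t, ∑ j : Fin d, y j • e j.succ t⟩

end Manifold

end FermiCoord

end

/-!
In Fermi coordinates the Christoffel symbols vanish on the axis, since the axis and the transversal
lines through it are geodesics and the frame is parallel, and the geodesic equation of the
transversal lines reads `∑ a b, x_a x_b Γ^i_{ab} = 0`. Cartan's formula for the transversal Euler
field `E` recovers a one-form from its contraction with `E` and from its curl up to inverting
`1 + E`, which is invertible on jets along the axis. The curl of `Γ` is the curvature up to terms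
quadratic in `Γ`, so two applications of Cartan's formula express the jets of `Γ` of order `m + 1`
by the jets of `Γ` and of `R` of order `m`. Similarly `∂T = ∇T - Γ * T` for `T = ∇^n R` expresses
the jets of `∇^n R` of order `m + 1` by jets of order `m`. As `∂_0 ∇^n R = 0` on the axis by local
symmetry, induction on `m` shows that all jets are constant along the axis.
-/

open scoped Topology Matrix

noncomputable section

namespace FermiCoord

section PartialDerivatives

variable {d : ℕ} {f g : Coord d → ℝ} {x : Coord d}

lemma pd_congr (h : f =ᶠ[𝓝 x] g) (i : Fin (d + 1)) : pd i f =ᶠ[𝓝 x] pd i g :=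
  (h.fderiv (𝕜 := ℝ)).mono fun y hy => by simp only [pd, hy]

lemma pdIter_congr (h : f =ᶠ[𝓝 x] g) (I : List (Fin (d + 1))) :
    pdIter I f =ᶠ[𝓝 x] pdIter I g := by
  induction I with
  | nil => exact h
  | cons i I ih => exact pd_congr ih i

lemma pdIter_append_singleton (I : List (Fin (d + 1))) (i : Fin (d + 1)) (f : Coord d → ℝ) :
    pdIter (I ++ [i]) f = pdIter I (pd i f) := by
  induction I with
  | nil => rfl
  | cons j I ih => simp only [List.cons_append, pdIter, ih]

lemma contDiffAt_pd (hf : ContDiffAt ℝ ∞ f x) (i : Fin (d + 1)) : ContDiffAt ℝ ∞ (pd i f) x :=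
  (hf.fderiv_right (m := ∞) (by simp)).clm_apply contDiffAt_const

lemma differentiableAt_pd (hf : ContDiffAt ℝ 2 f x) (i : Fin (d + 1)) :
    DifferentiableAt ℝ (pd i f) x :=
  ((hf.fderiv_right (m := 1) (by norm_num)).clm_apply contDiffAt_const).differentiableAt (by simp)

lemma contDiffAt_pdIter (hf : ContDiffAt ℝ ∞ f x) (I : List (Fin (d + 1))) :
    ContDiffAt ℝ ∞ (pdIter I f) x := by
  induction I with
  | nil => exact hf
  | cons i I ih => exact contDiffAt_pd ih i

lemma eventually_contDiffAt_nat (hf : ContDiffAt ℝ ∞ f x) (n : ℕ) :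
    ∀ᶠ y in 𝓝 x, ContDiffAt ℝ n f y :=
  (hf.of_le (mod_cast le_top)).eventually (by simp)

lemma eventually_differentiableAt (hf : ContDiffAt ℝ ∞ f x) :
    ∀ᶠ y in 𝓝 x, DifferentiableAt ℝ f y :=
  (eventually_contDiffAt_nat hf 1).mono fun _ hy => hy.differentiableAt (by simp)

lemma pd_const (i : Fin (d + 1)) (c : ℝ) (x : Coord d) : pd i (fun _ => c) x = 0 := by
  simp [pd]

lemma pd_add (hf : DifferentiableAt ℝ f x) (hg : DifferentiableAt ℝ g x) (i : Fin (d + 1)) :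
    pd i (fun y => f y + g y) x = pd i f x + pd i g x := by
  simp [pd, fderiv_fun_add hf hg]

lemma pd_mul (hf : DifferentiableAt ℝ f x) (hg : DifferentiableAt ℝ g x) (i : Fin (d + 1)) :
    pd i (fun y => f y * g y) x = f x * pd i g x + g x * pd i f x := by
  simp [pd, fderiv_fun_mul hf hg]

lemma pd_const_mul (hf : DifferentiableAt ℝ f x) (c : ℝ) (i : Fin (d + 1)) :
    pd i (fun y => c * f y) x = c * pd i f x := by
  simp [pd, fderiv_const_mul hf]

lemma pd_sum {ι : Type*} {s : Finset ι} {F : ι → Coord d → ℝ}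
    (hF : ∀ a ∈ s, DifferentiableAt ℝ (F a) x) (i : Fin (d + 1)) :
    pd i (fun y => ∑ a ∈ s, F a y) x = ∑ a ∈ s, pd i (F a) x := by
  simp [pd, fderiv_fun_sum hF]

lemma pd_coord (i j : Fin (d + 1)) (x : Coord d) :
    pd i (fun y => y j) x = if j = i then 1 else 0 := by
  have h : HasFDerivAt (fun y : Coord d => y j) (EuclideanSpace.proj (𝕜 := ℝ) j) x :=
    (EuclideanSpace.proj (𝕜 := ℝ) j : Coord d →L[ℝ] ℝ).hasFDerivAt
  simp [pd, h.fderiv, basisVec]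

lemma pd_coord_mul (hf : DifferentiableAt ℝ f x) (i j : Fin (d + 1)) :
    pd i (fun y => y j * f y) x = (if j = i then f x else 0) + x j * pd i f x := by
  rw [pd_mul (by fun_prop) hf, pd_coord]
  split_ifs <;> ring

lemma pd_comm (hf : ContDiffAt ℝ 2 f x) (i j : Fin (d + 1)) :
    pd i (pd j f) x = pd j (pd i f) x := by
  have hdiff : DifferentiableAt ℝ (fderiv ℝ f) x :=
    (hf.fderiv_right (m := 1) (by norm_num)).differentiableAt (by simp)
  have second_fderiv (a b : Fin (d + 1)) :
      pd a (pd b f) x = fderiv ℝ (fderiv ℝ f) x (basisVec a) (basisVec b) := by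
    change fderiv ℝ (fun y => fderiv ℝ f y (basisVec b)) x (basisVec a) = _
    simp [fderiv_clm_apply hdiff (differentiableAt_const _)]
  rw [second_fderiv, second_fderiv, (hf.isSymmSndFDerivAt (by simp)).eq]

end PartialDerivatives

section Axis

variable {d : ℕ} {f : Coord d → ℝ}

lemma axis_eq_smul_basisVec (t : ℝ) : (axis t : Coord d) = t • basisVec 0 := by
  ext i
  simp [axis, basisVec]

lemma axis_apply_succ (t : ℝ) (a : Fin d) : (axis t : Coord d) a.succ = 0 := by
  simp [axis]

lemma hasDerivAt_axis (t : ℝ) : HasDerivAt (axis : ℝ → Coord d) (basisVec 0) t := by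
  simpa [← axis_eq_smul_basisVec] using (hasDerivAt_id t).smul_const (basisVec 0 : Coord d)

lemma hasDerivAt_comp_axis {t : ℝ} (hf : DifferentiableAt ℝ f (axis t)) :
    HasDerivAt (fun s => f (axis s)) (pd 0 f (axis t)) t :=
  hf.hasFDerivAt.comp_hasDerivAt t (hasDerivAt_axis t)

lemma pd_zero_axis_of_eq (hf : ∀ t, DifferentiableAt ℝ f (axis t))
    (h : ∀ s t, f (axis s) = f (axis t)) (t : ℝ) : pd 0 f (axis t) = 0 :=
  (hasDerivAt_comp_axis (hf t)).unique
    ((hasDerivAt_const t (f (axis t))).congr_of_eventuallyEq (.of_forall fun s => h s t))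

lemma eq_on_axis_of_pd_zero (hf : ∀ t, DifferentiableAt ℝ f (axis t))
    (h : ∀ t, pd 0 f (axis t) = 0) (s t : ℝ) : f (axis s) = f (axis t) :=
  is_const_of_deriv_eq_zero (fun r => (hasDerivAt_comp_axis (hf r)).differentiableAt)
    (fun r => (hasDerivAt_comp_axis (hf r)).deriv.trans (h r)) s t

end Axis

section AxisConst

variable {d m : ℕ} {f g : Coord d → ℝ}

/-- The jets of order `m` of `f` do not depend on the point of the axis: `f` is smooth at every
point of the axis, and its partial derivatives of order at most `m` are constant along the axis. -/
structure IsAxisConst (m : ℕ) (f : Coord d → ℝ) : Prop where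
  contDiffAt : ∀ t, ContDiffAt ℝ ∞ f (axis t)
  pdIter_eq : ∀ I : List (Fin (d + 1)), I.length ≤ m →
    ∀ s t, pdIter I f (axis s) = pdIter I f (axis t)

namespace IsAxisConst

lemma mono {k : ℕ} (h : IsAxisConst m f) (hk : k ≤ m) : IsAxisConst k f :=
  ⟨h.contDiffAt, fun I hI => h.pdIter_eq I (hI.trans hk)⟩

lemma eq_on_axis (h : IsAxisConst m f) (s t : ℝ) : f (axis s) = f (axis t) :=
  h.pdIter_eq [] (Nat.zero_le m) s t

lemma pd_zero_pdIter (h : IsAxisConst m f) {I : List (Fin (d + 1))} (hI : I.length ≤ m) (t : ℝ) :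
    FermiCoord.pd 0 (pdIter I f) (axis t) = 0 :=
  pd_zero_axis_of_eq
    (fun s => (contDiffAt_pdIter (h.contDiffAt s) I).differentiableAt (by simp))
    (h.pdIter_eq I hI) t

lemma pd {k : ℕ} (h : IsAxisConst m f) (hk : k < m) (i : Fin (d + 1)) :
    IsAxisConst k (pd i f) where
  contDiffAt t := contDiffAt_pd (h.contDiffAt t) i
  pdIter_eq I hI := by
    simp only [← pdIter_append_singleton]
    exact h.pdIter_eq _ (by simp; lia)

/-- This recursion reduces closure properties to strong induction on the order. -/
lemma of_pd (hf : ∀ t, ContDiffAt ℝ ∞ f (axis t)) (heq : ∀ s t, f (axis s) = f (axis t))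
    (hpd : ∀ k < m, ∀ i, IsAxisConst k (FermiCoord.pd i f)) : IsAxisConst m f where
  contDiffAt := hf
  pdIter_eq I hI := by
    obtain rfl | ⟨I, i, rfl⟩ := I.eq_nil_or_concat'
    · exact heq
    · simp only [pdIter_append_singleton]
      exact (hpd I.length (Nat.lt_of_succ_le (by simpa using hI)) i).pdIter_eq I le_rfl

lemma succ (h : IsAxisConst m f) (hpd : ∀ i, IsAxisConst m (FermiCoord.pd i f)) :
    IsAxisConst (m + 1) f :=
  of_pd h.contDiffAt h.eq_on_axis fun _ hk i => (hpd i).mono (Nat.lt_succ_iff.1 hk)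

lemma congr (h : IsAxisConst m f) (hfg : ∀ t, f =ᶠ[𝓝 (axis t)] g) : IsAxisConst m g where
  contDiffAt t := (h.contDiffAt t).congr_of_eventuallyEq (hfg t).symm
  pdIter_eq I hI s t := by
    rw [← (pdIter_congr (hfg s) I).self_of_nhds, ← (pdIter_congr (hfg t) I).self_of_nhds]
    exact h.pdIter_eq I hI s t

lemma const (m : ℕ) (c : ℝ) : IsAxisConst m (fun _ : Coord d => c) := by
  induction m using Nat.strong_induction_on generalizing c with
  | _ m ih =>
    refine of_pd (fun _ => contDiffAt_const) (fun _ _ => rfl) fun k hk i => ?_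
    exact (ih k hk 0).congr fun t => .of_forall fun x => (pd_const i c x).symm

lemma add (hf : IsAxisConst m f) (hg : IsAxisConst m g) :
    IsAxisConst m (fun x => f x + g x) := by
  induction m using Nat.strong_induction_on generalizing f g with
  | _ m ih =>
    refine of_pd (fun t => (hf.contDiffAt t).add (hg.contDiffAt t))
      (fun s t => by rw [hf.eq_on_axis s t, hg.eq_on_axis s t]) fun k hk i => ?_
    refine (ih k hk (hf.pd hk i) (hg.pd hk i)).congr fun t => ?_
    filter_upwards [eventually_differentiableAt (hf.contDiffAt t),
      eventually_differentiableAt (hg.contDiffAt t)] with x hfx hgx using (pd_add hfx hgx i).symm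

lemma mul (hf : IsAxisConst m f) (hg : IsAxisConst m g) :
    IsAxisConst m (fun x => f x * g x) := by
  induction m using Nat.strong_induction_on generalizing f g with
  | _ m ih =>
    refine of_pd (fun t => (hf.contDiffAt t).mul (hg.contDiffAt t))
      (fun s t => by rw [hf.eq_on_axis s t, hg.eq_on_axis s t]) fun k hk i => ?_
    refine ((ih k hk (hf.mono hk.le) (hg.pd hk i)).add
      (ih k hk (hg.mono hk.le) (hf.pd hk i))).congr fun t => ?_
    filter_upwards [eventually_differentiableAt (hf.contDiffAt t),
      eventually_differentiableAt (hg.contDiffAt t)] with x hfx hgx using (pd_mul hfx hgx i).symm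

lemma const_mul (c : ℝ) (h : IsAxisConst m f) : IsAxisConst m (fun x => c * f x) :=
  (const m c).mul h

lemma sub (hf : IsAxisConst m f) (hg : IsAxisConst m g) :
    IsAxisConst m (fun x => f x - g x) := by
  simpa only [neg_one_mul, ← sub_eq_add_neg] using hf.add (hg.const_mul (-1))

lemma sum {ι : Type*} {s : Finset ι} {F : ι → Coord d → ℝ} (h : ∀ a ∈ s, IsAxisConst m (F a)) :
    IsAxisConst m (fun x => ∑ a ∈ s, F a x) := by
  classical
  induction s using Finset.induction_on with
  | empty => simpa only [Finset.sum_empty] using const m 0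
  | insert a s ha ih =>
    simp only [Finset.sum_insert ha]
    rw [Finset.forall_mem_insert] at h
    exact h.1.add (ih h.2)

lemma pd_zero (h : IsAxisConst m f) : IsAxisConst m (FermiCoord.pd 0 f) := by
  induction m using Nat.strong_induction_on generalizing f with
  | _ m ih =>
    have vanish := h.pd_zero_pdIter (I := []) (Nat.zero_le m)
    refine of_pd (fun t => contDiffAt_pd (h.contDiffAt t) 0)
      (fun s t => (vanish s).trans (vanish t).symm) fun k hk i => ?_
    refine (ih k hk (h.pd hk i)).congr fun t => ?_
    filter_upwards [eventually_contDiffAt_nat (h.contDiffAt t) 2] with x hx using pd_comm hx 0 i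

lemma of_pd_zero (hf : ∀ t, ContDiffAt ℝ ∞ f (axis t))
    (h : ∀ t, FermiCoord.pd 0 f (axis t) = 0) : IsAxisConst 0 f :=
  of_pd hf (eq_on_axis_of_pd_zero (fun t => (hf t).differentiableAt (by simp)) h)
    (by simp)

lemma coord_mul (hf : ∀ t, ContDiffAt ℝ ∞ f (axis t)) (h : ∀ k < m, IsAxisConst k f)
    (a : Fin d) : IsAxisConst m (fun x => x a.succ * f x) := by
  induction m using Nat.strong_induction_on generalizing f with
  | _ m ih =>
    refine of_pd (fun t => ContDiffAt.mul (by fun_prop) (hf t))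
      (fun s t => by simp only [axis_apply_succ, zero_mul]) fun k hk i => ?_
    have order_k_of_pd : IsAxisConst k fun x => x a.succ * FermiCoord.pd i f x :=
      ih k hk (fun t => contDiffAt_pd (hf t) i) fun l hl => (h k hk).pd hl i
    refine (((h k hk).const_mul (if a.succ = i then 1 else 0)).add order_k_of_pd).congr
      fun t => ?_
    filter_upwards [eventually_differentiableAt (hf t)] with x hx
    simp only [pd_coord_mul hx, ite_mul, one_mul, zero_mul]

end IsAxisConst

end AxisConst

section Radial

variable {d m : ℕ} {f : Coord d → ℝ} {α : Fin d → Coord d → ℝ} {x : Coord d}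

/-- The contraction `∑ a, x_a α_a` of the transversal components `α` of a one-form with the
transversal position vector. -/
def radial (α : Fin d → Coord d → ℝ) (x : Coord d) : ℝ := ∑ a, x a.succ * α a x

/-- The Euler operator `∑ a, x_a ∂_a` in the transversal variables. -/
def euler (f : Coord d → ℝ) : Coord d → ℝ := radial fun a => pd a.succ f

lemma radial_axis (α : Fin d → Coord d → ℝ) (t : ℝ) : radial α (axis t) = 0 := by
  simp [radial, axis_apply_succ]

lemma differentiableAt_radial (hα : ∀ a, DifferentiableAt ℝ (α a) x) :
    DifferentiableAt ℝ (radial α) x :=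
  DifferentiableAt.fun_sum fun a _ => DifferentiableAt.fun_mul (by fun_prop) (hα a)

lemma differentiableAt_euler (hf : ContDiffAt ℝ 2 f x) : DifferentiableAt ℝ (euler f) x :=
  differentiableAt_radial fun a => differentiableAt_pd hf a.succ

lemma pd_radial (hα : ∀ a, DifferentiableAt ℝ (α a) x) (i : Fin (d + 1)) :
    pd i (radial α) x
      = (∑ a : Fin d, if a.succ = i then α a x else 0) + radial (fun a => pd i (α a)) x := by
  change pd i (fun y => ∑ a, y a.succ * α a y) x = _
  rw [pd_sum fun a _ => DifferentiableAt.fun_mul (by fun_prop) (hα a)]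
  simp only [pd_coord_mul (hα _), Finset.sum_add_distrib, radial]

lemma pd_succ_radial (hα : ∀ a, DifferentiableAt ℝ (α a) x) (j : Fin d) :
    pd j.succ (radial α) x = α j x + radial (fun a => pd j.succ (α a)) x := by
  simp [pd_radial hα]

lemma pd_euler (hf : ContDiffAt ℝ 2 f x) (i : Fin (d + 1)) :
    pd i (euler f) x = (if i = 0 then 0 else 1) * pd i f x + euler (pd i f) x := by
  rw [euler, pd_radial fun a => differentiableAt_pd hf a.succ]
  congr 1
  · cases i using Fin.cases <;> simp
  · simp only [euler, radial, pd_comm hf i]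

/-- Cartan's formula `L_E α = d (ι_E α) + ι_E dα` for the transversal Euler field `E`. -/
lemma add_euler_eq (hα : ∀ a, DifferentiableAt ℝ (α a) x) (j : Fin d) :
    α j x + euler (α j) x = pd j.succ (radial α) x
      - radial (fun a y => pd j.succ (α a) y - pd a.succ (α j) y) x := by
  simp only [pd_succ_radial hα, euler, radial, mul_sub, Finset.sum_sub_distrib]
  ring

namespace IsAxisConst

lemma radial (h : ∀ a, IsAxisConst m (α a)) : IsAxisConst (m + 1) (radial α) :=
  sum fun a _ => coord_mul (h a).contDiffAt (fun _ hk => (h a).mono (Nat.lt_succ_iff.1 hk)) a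

lemma of_euler {c : ℝ} (hc : 0 < c) (hf : ∀ t, ContDiffAt ℝ ∞ f (axis t))
    (h : IsAxisConst m fun x => c * f x + euler f x) : IsAxisConst m f := by
  induction m using Nat.strong_induction_on generalizing f c with
  | _ m ih =>
    refine of_pd hf (fun s t => ?_) fun k hk i => ?_
    · have := h.eq_on_axis s t
      simpa [euler, radial_axis, hc.ne'] using this
    · refine ih k hk (c := c + if i = 0 then 0 else 1) (by split_ifs <;> linarith)
        (fun t => contDiffAt_pd (hf t) i) ((h.pd hk i).congr fun t => ?_)
      filter_upwards [eventually_contDiffAt_nat (hf t) 2] with x hx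
      have hfx : DifferentiableAt ℝ f x := hx.differentiableAt (by simp)
      rw [pd_add (hfx.const_mul c) (differentiableAt_euler hx), pd_const_mul hfx, pd_euler hx]
      ring

/-- By Cartan's formula `α + E α` is controlled by the derivatives of the contraction of `α` and
by its curl, and the operator `1 + E` can be inverted on jets along the axis. -/
lemma of_radial_of_curl (hα : ∀ a t, ContDiffAt ℝ ∞ (α a) (axis t))
    (hrad : IsAxisConst (m + 2) (FermiCoord.radial α))
    (hcurl : ∀ j a : Fin d,
      IsAxisConst m fun x => FermiCoord.pd j.succ (α a) x - FermiCoord.pd a.succ (α j) x)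
    (j : Fin d) : IsAxisConst (m + 1) (α j) := by
  refine of_euler one_pos (hα j) (((hrad.pd (by lia) j.succ).sub (radial (hcurl j))).congr
    fun t => ?_)
  filter_upwards [Filter.eventually_all.2 fun a => eventually_differentiableAt (hα a t)]
    with x hx
  rw [one_mul, add_euler_eq hx]

end IsAxisConst

/-- The one-form to which Cartan's formula is applied first is the contraction
`V_l = ∑ a, x_a Γ_{al}`, whose own contraction vanishes; its curl only involves the curl of `Γ`
since the terms `Γ_{jl} - Γ_{lj}` cancel. The second application is to `Γ_{·l}`. -/
lemma isAxisConst_succ_of_radial_radial_eq_zero {Γ : Fin (d + 1) → Fin (d + 1) → Coord d → ℝ}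
    (hΓ : ∀ j k, IsAxisConst m (Γ j k)) (hsymm : ∀ j k, Γ j k = Γ k j)
    (hrad : ∀ t, radial (fun b => radial fun a => Γ a.succ b.succ) =ᶠ[𝓝 (axis t)] 0)
    (hcurl : ∀ j k l, IsAxisConst m fun x => pd j (Γ k l) x - pd k (Γ j l) x)
    (j k : Fin (d + 1)) : IsAxisConst (m + 1) (Γ j k) := by
  have hdiff (t : ℝ) : ∀ᶠ x in 𝓝 (axis t), ∀ j k, DifferentiableAt ℝ (Γ j k) x :=
    Filter.eventually_all.2 fun j => Filter.eventually_all.2 fun k =>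
      eventually_differentiableAt ((hΓ j k).contDiffAt t)
  have contraction (l : Fin d) : IsAxisConst (m + 2) (radial fun a => Γ a.succ l.succ) := by
    refine IsAxisConst.of_radial_of_curl (α := fun l => radial fun a => Γ a.succ l.succ)
      (fun l => (IsAxisConst.radial fun a => hΓ a.succ l.succ).contDiffAt)
      ((IsAxisConst.const _ 0).congr fun t => (hrad t).symm) (fun j k => ?_) l
    refine (IsAxisConst.radial fun a => hcurl j.succ k.succ a.succ).congr fun t => ?_
    filter_upwards [hdiff t] with x hx
    rw [pd_succ_radial fun a => hx a.succ k.succ, pd_succ_radial fun a => hx a.succ j.succ,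
      hsymm k.succ j.succ, add_sub_add_left_eq_sub]
    simp only [radial, mul_sub, Finset.sum_sub_distrib, hsymm j.succ, hsymm k.succ]
  have transversal_transversal (j l : Fin d) : IsAxisConst (m + 1) (Γ j.succ l.succ) :=
    IsAxisConst.of_radial_of_curl (fun a => (hΓ a.succ l.succ).contDiffAt) (contraction l)
      (fun j a => hcurl j.succ a.succ l.succ) j
  have zero_left (l : Fin (d + 1)) : IsAxisConst (m + 1) (Γ 0 l) :=
    (hΓ 0 l).succ fun i => by
      simpa only [sub_add_cancel] using (hcurl i 0 l).add (hΓ i l).pd_zero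
  cases j using Fin.cases with
  | zero => exact zero_left k
  | succ j =>
    cases k using Fin.cases with
    | zero => exact hsymm 0 j.succ ▸ zero_left j.succ
    | succ k => exact transversal_transversal j k

end Radial

section Smoothness

lemma contDiffAt_det {𝕜 E ι : Type*} [NontriviallyNormedField 𝕜] [NormedAddCommGroup E]
    [NormedSpace 𝕜 E] [Fintype ι] [DecidableEq ι] {n : WithTop ℕ∞} {A : E → Matrix ι ι 𝕜} {x : E}
    (hA : ∀ i j, ContDiffAt 𝕜 n (fun y => A y i j) x) :
    ContDiffAt 𝕜 n (fun y => (A y).det) x := by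
  simp only [Matrix.det_apply']
  exact ContDiffAt.sum fun τ _ => contDiffAt_const.mul (contDiffAt_prod fun i _ => hA _ _)

lemma contDiffAt_matrix_inv {𝕜 E ι : Type*} [NontriviallyNormedField 𝕜] [NormedAddCommGroup E]
    [NormedSpace 𝕜 E] [Fintype ι] [DecidableEq ι] {n : WithTop ℕ∞} {A : E → Matrix ι ι 𝕜} {x : E}
    (hA : ∀ i j, ContDiffAt 𝕜 n (fun y => A y i j) x) (hdet : (A x).det ≠ 0) (i j : ι) :
    ContDiffAt 𝕜 n (fun y => (A y)⁻¹ i j) x := by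
  simp only [Matrix.inv_def, Matrix.smul_apply, Matrix.adjugate_apply, Ring.inverse_eq_inv',
    smul_eq_mul]
  refine ((contDiffAt_det hA).inv hdet).mul (contDiffAt_det fun k l => ?_)
  by_cases hk : k = j
  · simpa only [hk, Matrix.updateRow_self] using contDiffAt_const
  · simpa only [Matrix.updateRow_ne hk] using hA k l

variable {d : ℕ} {g : Coord d → Matrix (Fin (d + 1)) (Fin (d + 1)) ℝ} {x : Coord d}

lemma contDiffAt_christoffel (hg : ∀ i j, ContDiffAt ℝ ∞ (fun y => g y i j) x)
    (hdet : (g x).det ≠ 0) (k i j : Fin (d + 1)) : ContDiffAt ℝ ∞ (christoffel g k i j) x :=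
  contDiffAt_const.mul <| ContDiffAt.sum fun l _ => (contDiffAt_matrix_inv hg hdet k l).mul
    (((contDiffAt_pd (hg j l) i).add (contDiffAt_pd (hg i l) j)).sub (contDiffAt_pd (hg i j) l))

lemma contDiffAt_riemann (hΓ : ∀ i j k, ContDiffAt ℝ ∞ (christoffel g i j k) x)
    (i j k l : Fin (d + 1)) : ContDiffAt ℝ ∞ (riemann g i j k l) x :=
  ((contDiffAt_pd (hΓ i k l) j).sub (contDiffAt_pd (hΓ i j l) k)).add
    (ContDiffAt.sum fun m _ => ((hΓ i j m).mul (hΓ m k l)).sub ((hΓ i k m).mul (hΓ m j l)))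

lemma contDiffAt_covDeriv (hΓ : ∀ i j k, ContDiffAt ℝ ∞ (christoffel g i j k) x) {m : ℕ}
    {T : TensorComp d m} (hT : ∀ i J, ContDiffAt ℝ ∞ (T i J) x) (i : Fin (d + 1))
    (J : Fin (m + 1) → Fin (d + 1)) : ContDiffAt ℝ ∞ (covDeriv g T i J) x :=
  ((contDiffAt_pd (hT i _) _).add (ContDiffAt.sum fun a _ => (hΓ _ _ _).mul (hT a _))).sub
    (ContDiffAt.sum fun _ _ => ContDiffAt.sum fun _ _ => (hΓ _ _ _).mul (hT i _))

lemma contDiffAt_iterCovRiemann (hΓ : ∀ i j k, ContDiffAt ℝ ∞ (christoffel g i j k) x) (n : ℕ) :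
    ∀ i J, ContDiffAt ℝ ∞ (iterCovRiemann g n i J) x := by
  induction n with
  | zero => exact fun i J => contDiffAt_riemann hΓ i (J 0) (J 1) (J 2)
  | succ n ih => exact contDiffAt_covDeriv hΓ ih

end Smoothness

section Congruence

variable {d : ℕ} {g g' : Coord d → Matrix (Fin (d + 1)) (Fin (d + 1)) ℝ} {x : Coord d}

lemma christoffel_congr (h : g =ᶠ[𝓝 x] g') (k i j : Fin (d + 1)) :
    christoffel g k i j =ᶠ[𝓝 x] christoffel g' k i j := by
  have hpd : ∀ᶠ y in 𝓝 x, ∀ a b c, pd a (fun z => g z b c) y = pd a (fun z => g' z b c) y := by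
    simp only [Filter.eventually_all]
    exact fun a b c => pd_congr (h.mono fun y hy => by simp only [hy]) a
  filter_upwards [h, hpd] with y hy hpdy
  simp only [christoffel, hy, hpdy]

lemma riemann_congr (h : g =ᶠ[𝓝 x] g') (i j k l : Fin (d + 1)) :
    riemann g i j k l =ᶠ[𝓝 x] riemann g' i j k l := by
  have hΓ : ∀ᶠ y in 𝓝 x, ∀ a b c, christoffel g a b c y = christoffel g' a b c y := by
    simpa only [Filter.EventuallyEq, Filter.eventually_all] using christoffel_congr h
  filter_upwards [hΓ, pd_congr (christoffel_congr h i k l) j,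
    pd_congr (christoffel_congr h i j l) k] with y hy hj hk
  simp only [riemann, hy, hj, hk]

lemma covDeriv_congr (h : g =ᶠ[𝓝 x] g') {m : ℕ} {T T' : TensorComp d m}
    (hT : ∀ i J, T i J =ᶠ[𝓝 x] T' i J) (i : Fin (d + 1)) (J : Fin (m + 1) → Fin (d + 1)) :
    covDeriv g T i J =ᶠ[𝓝 x] covDeriv g' T' i J := by
  have hΓ : ∀ᶠ y in 𝓝 x, ∀ a b c, christoffel g a b c y = christoffel g' a b c y := by
    simpa only [Filter.EventuallyEq, Filter.eventually_all] using christoffel_congr h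
  have hT' : ∀ᶠ y in 𝓝 x, ∀ i J, T i J y = T' i J y := by
    simpa only [Filter.EventuallyEq, Filter.eventually_all] using hT
  filter_upwards [hΓ, hT', pd_congr (hT i (Fin.tail J)) (J 0)] with y hy hTy hpd
  simp only [covDeriv, hy, hTy, hpd]

lemma iterCovRiemann_congr (h : g =ᶠ[𝓝 x] g') (n : ℕ) :
    ∀ i J, iterCovRiemann g n i J =ᶠ[𝓝 x] iterCovRiemann g' n i J := by
  induction n with
  | zero => exact fun i J => riemann_congr h i (J 0) (J 1) (J 2)
  | succ n ih => exact covDeriv_congr h ih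

end Congruence

section Propagation

variable {d m : ℕ} {g : Coord d → Matrix (Fin (d + 1)) (Fin (d + 1)) ℝ}

lemma christoffel_symm (hsymm : ∀ x, (g x).IsSymm) (k i j : Fin (d + 1)) :
    christoffel g k i j = christoffel g k j i := by
  funext x
  have hij : (fun y => g y i j) = fun y => g y j i := funext fun y => (hsymm y).apply j i
  simp only [christoffel, hij, add_comm (pd i _ x)]

lemma covDeriv_cons_of_christoffel_eq_zero {x : Coord d} (hΓ : ∀ i j k, christoffel g i j k x = 0)
    {n : ℕ} (T : TensorComp d n) (i k : Fin (d + 1)) (J : Fin n → Fin (d + 1)) :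
    covDeriv g T i (Fin.cons k J : Fin (n + 1) → Fin (d + 1)) x = pd k (T i J) x := by
  simp [covDeriv, hΓ]

lemma isAxisConst_curl_christoffel (hΓ : ∀ i j k, IsAxisConst m (christoffel g i j k))
    (hR : ∀ i j k l, IsAxisConst m (riemann g i j k l)) (i j k l : Fin (d + 1)) :
    IsAxisConst m fun x => pd j (christoffel g i k l) x - pd k (christoffel g i j l) x := by
  have quadratic : IsAxisConst m fun x => ∑ a, (christoffel g i j a x * christoffel g a k l x
      - christoffel g i k a x * christoffel g a j l x) :=
    .sum fun a _ => ((hΓ i j a).mul (hΓ a k l)).sub ((hΓ i k a).mul (hΓ a j l))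
  simpa only [riemann, add_sub_cancel_right] using (hR i j k l).sub quadratic

lemma isAxisConst_succ_of_covDeriv (hΓ : ∀ i j k, IsAxisConst m (christoffel g i j k)) {n : ℕ}
    {T : TensorComp d n} (hT : ∀ i J, IsAxisConst m (T i J))
    (hDT : ∀ i J, IsAxisConst m (covDeriv g T i J)) (i : Fin (d + 1)) (J : Fin n → Fin (d + 1)) :
    IsAxisConst (m + 1) (T i J) := by
  refine (hT i J).succ fun k => ?_
  have upper : IsAxisConst m fun x => ∑ a, christoffel g i k a x * T a J x :=
    .sum fun a _ => (hΓ i k a).mul (hT a J)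
  have lower : IsAxisConst m fun x =>
      ∑ p : Fin n, ∑ a, christoffel g a k (J p) x * T i (Function.update J p a) x :=
    .sum fun p _ => .sum fun a _ => (hΓ a k (J p)).mul (hT i _)
  simpa only [covDeriv, Fin.cons_zero, Fin.tail_cons, sub_add_cancel, add_sub_cancel_right]
    using ((hDT i (Fin.cons k J)).add lower).sub upper

/-- Jets of `∇^{n+1} R` and of `Γ` of order `m` determine the jets of `∇^n R` of order `m + 1`, so
the induction on `m` has to treat all `n` simultaneously. -/
lemma isAxisConst_christoffel_and_iterCovRiemann (hsymm : ∀ x, (g x).IsSymm)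
    (hΓ : ∀ i j k t, ContDiffAt ℝ ∞ (christoffel g i j k) (axis t))
    (hΓ_axis : ∀ i j k t, christoffel g i j k (axis t) = 0)
    (hrad : ∀ i t,
      radial (fun b => radial fun a => christoffel g i a.succ b.succ) =ᶠ[𝓝 (axis t)] 0)
    (hR : ∀ n i (J : Fin (3 + n) → Fin (d + 1)) t,
      covDeriv g (iterCovRiemann g n) i (Fin.cons 0 J : Fin (3 + n + 1) → Fin (d + 1))
        (axis t) = 0) (m : ℕ) :
    (∀ i j k, IsAxisConst m (christoffel g i j k)) ∧
      ∀ n i J, IsAxisConst m (iterCovRiemann g n i J) := by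
  induction m with
  | zero =>
    refine ⟨fun i j k => .of_pd (hΓ i j k) (fun s t => by simp only [hΓ_axis]) (by simp),
      fun n i J => .of_pd_zero (fun t => contDiffAt_iterCovRiemann (hΓ · · · t) n i J)
        fun t => ?_⟩
    rw [← covDeriv_cons_of_christoffel_eq_zero (hΓ_axis · · · t)]
    exact hR n i J t
  | succ m ih =>
    obtain ⟨ihΓ, ihR⟩ := ih
    have riemann_const (i j k l) : IsAxisConst m (riemann g i j k l) := ihR 0 i ![j, k, l]
    exact ⟨fun i => isAxisConst_succ_of_radial_radial_eq_zero (ihΓ i) (christoffel_symm hsymm i)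
        (hrad i) (isAxisConst_curl_christoffel ihΓ riemann_const i),
      fun n => isAxisConst_succ_of_covDeriv ihΓ (ihR n) (ihR (n + 1))⟩

end Propagation

section MetricComponents

lemma contMDiffAt_mfderiv_const {E F H M : Type*} [NormedAddCommGroup E] [NormedSpace ℝ E]
    [NormedAddCommGroup F] [NormedSpace ℝ F] [TopologicalSpace H] {I : ModelWithCorners ℝ F H}
    [TopologicalSpace M] [ChartedSpace H M] [IsManifold I ∞ M] {U : Set E} {ψ : E → M} {x : E}
    (hψ : ContMDiffOn 𝓘(ℝ, E) I ∞ ψ U) (hU : U ∈ 𝓝 x) (v : E) :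
    ContMDiffAt 𝓘(ℝ, E) I.tangent ∞
      (fun y => (⟨ψ y, mfderiv 𝓘(ℝ, E) I ψ y v⟩ : TangentBundle I M)) x := by
  obtain ⟨V, hVU, hV, hxV⟩ := mem_nhds_iff.1 hU
  have const_section : ContMDiff 𝓘(ℝ, E) 𝓘(ℝ, E).tangent ∞
      (fun y : E => (⟨y, v⟩ : TangentBundle 𝓘(ℝ, E) E)) :=
    fun y => contMDiffAt_vectorSpace_iff_contDiffAt.2 contDiffAt_const
  have pushforward := ((hψ.mono hVU).contMDiffOn_tangentMapWithin (m := ∞) (by simp)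
    hV.uniqueMDiffOn).comp const_section.contMDiffOn (s := V) fun y hy => hy
  refine (pushforward.contMDiffAt (hV.mem_nhds hxV)).congr_of_eventuallyEq ?_
  filter_upwards [hV.mem_nhds hxV] with y hy
  simp only [Function.comp_apply, tangentMapWithin, mfderivWithin_of_isOpen hV hy]

variable {d : ℕ} {N : Type*} [TopologicalSpace N] [ChartedSpace (Coord d) N]
  [IsManifold (𝓡 (d + 1)) ∞ N] (h : Metric d N) {ψ ψ' : Coord d → N} {x : Coord d}

lemma contDiffAt_metricComp {U : Set (Coord d)} (hψ : ContMDiffOn (𝓡 (d + 1)) (𝓡 (d + 1)) ∞ ψ U)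
    (hU : U ∈ 𝓝 x) (i j : Fin (d + 1)) : ContDiffAt ℝ ∞ (fun y => metricComp h ψ y i j) x := by
  have total : ContMDiffAt (𝓡 (d + 1)) ((𝓡 (d + 1)).prod 𝓘(ℝ)) ∞
      (fun y => Bundle.TotalSpace.mk' ℝ (E := Bundle.Trivial N ℝ) (ψ y)
        (metricComp h ψ y i j)) x :=
    ContMDiffAt.clm_bundle_apply₂ (F₁ := Coord d) (F₂ := Coord d)
      (h.contMDiff.contMDiffAt.comp x (hψ.contMDiffAt hU))
      (contMDiffAt_mfderiv_const hψ hU (basisVec i)) (contMDiffAt_mfderiv_const hψ hU (basisVec j))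
  exact (Bundle.contMDiffAt_totalSpace.1 total).2.contDiffAt

lemma isSymm_metricComp (ψ : Coord d → N) (x : Coord d) : (metricComp h ψ x).IsSymm :=
  Matrix.IsSymm.ext fun _ _ => h.symm _ _ _

lemma posDef_metricComp (hψ : Function.Injective (mfderiv (𝓡 (d + 1)) (𝓡 (d + 1)) ψ x)) :
    (metricComp h ψ x).PosDef := by
  let D : Coord d →L[ℝ] TangentSpace (𝓡 (d + 1)) (ψ x) := mfderiv (𝓡 (d + 1)) (𝓡 (d + 1)) ψ x
  refine .of_dotProduct_mulVec_pos (isSymm_metricComp h ψ x) fun v hv => ?_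
  have hDv : D (WithLp.toLp 2 v) = ∑ i, v i • D (basisVec i) := by
    simp only [← map_smul, ← map_sum]
    congr 1
    ext i
    simp [basisVec, Finset.sum_apply, Pi.single_apply]
  have hDv_ne : D (WithLp.toLp 2 v) ≠ 0 := fun h0 =>
    hv ((WithLp.toLp_eq_zero 2).1 (hψ (h0.trans (map_zero D).symm)))
  have expand : h.inner (ψ x) (D (WithLp.toLp 2 v)) (D (WithLp.toLp 2 v))
      = star v ⬝ᵥ metricComp h ψ x *ᵥ v := by
    simp only [hDv, map_sum, map_smul, sum_apply, smul_apply, smul_eq_mul, dotProduct,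
      Matrix.mulVec, metricComp, Matrix.of_apply, star_trivial, Finset.mul_sum]
    rw [Finset.sum_comm]
    refine Finset.sum_congr rfl fun i _ => Finset.sum_congr rfl fun j _ => ?_
    change _ = v i * (h.inner (ψ x) (D (basisVec i)) (D (basisVec j)) * v j)
    ring
  exact expand ▸ h.pos (ψ x) _ hDv_ne

lemma metricComp_congr (hψ : ψ =ᶠ[𝓝 x] ψ') : metricComp h ψ =ᶠ[𝓝 x] metricComp h ψ' := by
  filter_upwards [hψ.eventuallyEq_nhds] with y hy
  have inner_congr {p q : N} (hpq : p = q) (v w : Coord d) :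
      h.inner p (v : TangentSpace (𝓡 (d + 1)) p) (w : TangentSpace (𝓡 (d + 1)) p)
        = h.inner q (v : TangentSpace (𝓡 (d + 1)) q) (w : TangentSpace (𝓡 (d + 1)) q) := by
    subst hpq; rfl
  ext i j
  simp only [metricComp, Matrix.of_apply]
  rw [hy.mfderiv_eq (I := 𝓡 (d + 1)) (I' := 𝓡 (d + 1))]
  exact inner_congr hy.eq_of_nhds _ _

end MetricComponents

section Charts

variable {E N : Type*} [NormedAddCommGroup E] [NormedSpace ℝ E] [TopologicalSpace N]
  [ChartedSpace E N] [IsManifold 𝓘(ℝ, E) ∞ N]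

lemma exists_chart_of_isLocalDiffeomorphAt {σ : E → N} {x : E}
    (hσ : IsLocalDiffeomorphAt 𝓘(ℝ, E) 𝓘(ℝ, E) ∞ σ x) :
    ∃ φ ∈ IsManifold.maximalAtlas 𝓘(ℝ, E) ∞ N,
      σ x ∈ φ.source ∧ σ =ᶠ[𝓝 x] φ.symm ∧ φ ∘ σ =ᶠ[𝓝 x] id := by
  obtain ⟨Φ, hx, hΦ⟩ := hσ
  have hxΦ := Φ.open_source.mem_nhds hx
  refine ⟨Φ.toOpenPartialHomeomorph.symm,
    Φ.toOpenPartialHomeomorph.symm.mem_maximalAtlas_of_contMDiffOn Φ.contMDiffOn_invFun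
      Φ.contMDiffOn_toFun, ?_, hΦ.eventuallyEq_of_mem hxΦ, ?_⟩
  · exact hΦ hx ▸ Φ.toOpenPartialHomeomorph.map_source hx
  · filter_upwards [hxΦ] with y hy
    rw [Function.comp_apply, hΦ hy]
    exact Φ.toOpenPartialHomeomorph.left_inv hy

end Charts

section Lines

variable {d : ℕ}

lemma hasDerivAt_line {E : Type*} [NormedAddCommGroup E] [NormedSpace ℝ E] (q v : E) (t : ℝ) :
    HasDerivAt (fun s : ℝ => q + s • v) v t := by
  simpa using ((hasDerivAt_id t).smul_const v).const_add q

lemma transversal_zero_apply (y : Fin d → ℝ) : transversal y 0 = 0 := rfl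

lemma transversal_succ_apply (y : Fin d → ℝ) (a : Fin d) : transversal y a.succ = y a := rfl

lemma axis_add_transversal (x : Coord d) :
    (axis (x 0) + transversal fun a => x a.succ : Coord d) = x := by
  ext i
  cases i using Fin.cases <;> simp [axis, transversal]

lemma eventually_deriv_coord_of_eq_line {c : ℝ → Coord d} {q v : Coord d} {t : ℝ}
    (hc : c =ᶠ[𝓝 t] fun s => q + s • v) (i : Fin (d + 1)) :
    deriv (fun s => c s i) =ᶠ[𝓝 t] fun _ => v i := by
  have coord : (fun s => c s i) =ᶠ[𝓝 t] fun s => q i + s • v i :=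
    hc.mono fun s hs => by simp [hs]
  exact coord.deriv.trans (.of_eq (funext fun s => (hasDerivAt_line (q i) (v i) s).deriv))

variable {N : Type*} [TopologicalSpace N] [ChartedSpace (Coord d) N]

lemma mfderiv_velocity {φ : N → Coord d} {c : ℝ → N} {t : ℝ}
    (hφ : MDifferentiableAt (𝓡 (d + 1)) (𝓡 (d + 1)) φ (c t))
    (hc : MDifferentiableAt 𝓘(ℝ, ℝ) (𝓡 (d + 1)) c t) :
    mfderiv (𝓡 (d + 1)) (𝓡 (d + 1)) φ (c t) (velocity c t) = deriv (φ ∘ c) t := by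
  rw [← fderiv_apply_one_eq_deriv, ← mfderiv_eq_fderiv, mfderiv_comp t hφ hc]
  rfl

variable [IsManifold (𝓡 (d + 1)) ∞ N]

lemma christoffel_of_geodesic_line (h : Metric d N) {σ : Coord d → N} {q v : Coord d} {S : Set ℝ}
    (hc : IsGeodesicOn h (fun s => σ (q + s • v)) S) {t : ℝ} (ht : t ∈ S)
    (hσ : IsLocalDiffeomorphAt (𝓡 (d + 1)) (𝓡 (d + 1)) ∞ σ (q + t • v)) (i : Fin (d + 1)) :
    ∑ j, ∑ k, christoffel (metricComp h σ) i j k (q + t • v) * v j * v k = 0 := by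
  obtain ⟨φ, hφ, hs, hsymm, hinv⟩ := exists_chart_of_isLocalDiffeomorphAt hσ
  have hline : (fun s : ℝ => φ (σ (q + s • v))) =ᶠ[𝓝 t] fun s => q + s • v :=
    hinv.comp_tendsto (hasDerivAt_line q v t).continuousAt
  have hd := eventually_deriv_coord_of_eq_line hline
  have acceleration : deriv (deriv fun s => φ (σ (q + s • v)) i) t = 0 := by
    rw [(hd i).deriv_eq, deriv_const]
  have Γ_eq (j k) := (christoffel_congr (metricComp_congr h hsymm) i j k).eq_of_nhds
  simpa only [acceleration, zero_add, (hd _).eq_of_nhds, hline.eq_of_nhds, ← Γ_eq]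
    using hc.2 φ hφ t ht hs i

end Lines

namespace IsFermiCoordinates

variable {d : ℕ} {N : Type*} [TopologicalSpace N] [ChartedSpace (Coord d) N]
  [IsManifold (𝓡 (d + 1)) ∞ N] {h : Metric d N} {γ : ℝ → N}
  {e : Fin (d + 1) → (t : ℝ) → TangentSpace (𝓡 (d + 1)) (γ t)} {U : Set (Coord d)}
  {σ : Coord d → N}

lemma isLocalDiffeomorphAt (hσ : IsFermiCoordinates h γ e U σ) {x : Coord d} (hx : x ∈ U) :
    IsLocalDiffeomorphAt (𝓡 (d + 1)) (𝓡 (d + 1)) ∞ σ x :=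
  hσ.isLocalDiffeomorphOn ⟨x, hx⟩

lemma contDiffAt_christoffel (hσ : IsFermiCoordinates h γ e U σ) {x : Coord d} (hx : x ∈ U)
    (k i j : Fin (d + 1)) : ContDiffAt ℝ ∞ (christoffel (metricComp h σ) k i j) x :=
  FermiCoord.contDiffAt_christoffel
    (contDiffAt_metricComp h hσ.isLocalDiffeomorphOn.contMDiffOn (hσ.isOpen.mem_nhds hx))
    (posDef_metricComp h
      ((hσ.isLocalDiffeomorphAt hx).mfderivToContinuousLinearEquiv (by simp)).injective).det_pos.ne'
    k i j

lemma apply_axis (hσ : IsFermiCoordinates h γ e U σ) (t : ℝ) : σ (axis t) = γ t := by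
  simpa using congrArg Bundle.TotalSpace.proj (hσ.initial t 0)

lemma sum_christoffel_transversal_eq_zero (hσ : IsFermiCoordinates h γ e U σ) (i : Fin (d + 1))
    (t : ℝ) (y : Fin d → ℝ) {s : ℝ} (hs : axis t + s • transversal y ∈ U) :
    ∑ b : Fin d, ∑ a : Fin d, y b * (y a *
      christoffel (metricComp h σ) i a.succ b.succ (axis t + s • transversal y)) = 0 := by
  have := christoffel_of_geodesic_line h (hσ.geodesic t y) hs (hσ.isLocalDiffeomorphAt hs) i
  simp only [Fin.sum_univ_succ, transversal_zero_apply, transversal_succ_apply, mul_zero,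
    zero_mul, zero_add, Finset.sum_const_zero] at this
  rw [Finset.sum_comm, ← this]
  exact Finset.sum_congr rfl fun a _ => Finset.sum_congr rfl fun b _ => by ring

lemma radial_radial_christoffel (hσ : IsFermiCoordinates h γ e U σ) (i : Fin (d + 1)) (t : ℝ) :
    radial (fun b => radial fun a => christoffel (metricComp h σ) i a.succ b.succ)
      =ᶠ[𝓝 (axis t)] 0 := by
  filter_upwards [hσ.isOpen.mem_nhds (hσ.axis_mem t)] with x hx
  have := hσ.sum_christoffel_transversal_eq_zero i (x 0) (fun a => x a.succ) (s := 1)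
    (by rwa [one_smul, axis_add_transversal])
  simpa only [one_smul, axis_add_transversal, radial, Finset.mul_sum, Pi.zero_apply] using this

lemma christoffel_succ_succ_axis (hσ : IsFermiCoordinates h γ e U σ) (i : Fin (d + 1))
    (a b : Fin d) (t : ℝ) : christoffel (metricComp h σ) i a.succ b.succ (axis t) = 0 := by
  have quadratic (y : Fin d → ℝ) : ∑ b : Fin d, ∑ a : Fin d, y b * (y a *
      christoffel (metricComp h σ) i a.succ b.succ (axis t)) = 0 := by
    simpa using hσ.sum_christoffel_transversal_eq_zero i t y (s := 0) (by simpa using hσ.axis_mem t)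
  have diagonal (a : Fin d) : christoffel (metricComp h σ) i a.succ a.succ (axis t) = 0 := by
    simpa [Pi.single_apply] using quadratic (Pi.single a 1)
  have polarized := quadratic (Pi.single a 1 + Pi.single b 1)
  simp only [Pi.add_apply, Pi.single_apply, add_mul, mul_add, Finset.sum_add_distrib, ite_mul,
    one_mul, zero_mul, mul_ite, mul_zero, Finset.sum_ite_eq', Finset.mem_univ, if_true,
    diagonal] at polarized
  rw [christoffel_symm (isSymm_metricComp h σ) i b.succ] at polarized
  linarith

lemma christoffel_zero_zero_axis (hσ : IsFermiCoordinates h γ e U σ)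
    (hγ : IsGeodesicOn h γ Set.univ) (i : Fin (d + 1)) (t : ℝ) :
    christoffel (metricComp h σ) i 0 0 (axis t) = 0 := by
  have axis_eq_line (s : ℝ) : (axis s : Coord d) = 0 + s • basisVec 0 := by
    rw [zero_add, axis_eq_smul_basisVec]
  have γ_eq : γ = fun s => σ (0 + s • basisVec 0) :=
    funext fun s => by rw [← axis_eq_line, hσ.apply_axis]
  have := christoffel_of_geodesic_line h (γ_eq ▸ hγ) (Set.mem_univ t)
    (axis_eq_line t ▸ hσ.isLocalDiffeomorphAt (hσ.axis_mem t)) i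
  rw [← axis_eq_line] at this
  simpa [basisVec, Pi.single_apply] using this

lemma exists_chart_axis (hσ : IsFermiCoordinates h γ e U σ) (t : ℝ) :
    ∃ φ ∈ IsManifold.maximalAtlas (𝓡 (d + 1)) ∞ N, γ t ∈ φ.source ∧ φ (γ t) = axis t ∧
      φ ∘ σ =ᶠ[𝓝 (axis t)] id ∧ metricComp h φ.symm =ᶠ[𝓝 (axis t)] metricComp h σ := by
  obtain ⟨φ, hφ, hs, hsymm, hinv⟩ :=
    exists_chart_of_isLocalDiffeomorphAt (hσ.isLocalDiffeomorphAt (hσ.axis_mem t))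
  rw [hσ.apply_axis] at hs
  exact ⟨φ, hφ, hs, hσ.apply_axis t ▸ hinv.eq_of_nhds, hinv, metricComp_congr h hsymm.symm⟩

lemma continuous_curve (hσ : IsFermiCoordinates h γ e U σ) : Continuous γ := by
  rw [← funext hσ.apply_axis]
  exact continuous_iff_continuousAt.2 fun t =>
    (hσ.isLocalDiffeomorphAt (hσ.axis_mem t)).contMDiffAt.continuousAt.comp
      (hasDerivAt_axis t).continuousAt

lemma deriv_coord_chart_curve (hσ : IsFermiCoordinates h γ e U σ) {φ : N → Coord d} {t : ℝ}
    (hφσ : φ ∘ σ =ᶠ[𝓝 (axis t)] id) (k : Fin (d + 1)) :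
    deriv (fun s => φ (γ s) k) t = (basisVec 0 : Coord d) k := by
  refine (eventually_deriv_coord_of_eq_line (q := 0) ?_ k).eq_of_nhds
  filter_upwards [hφσ.comp_tendsto (hasDerivAt_axis t).continuousAt] with s hs
  rw [zero_add, ← axis_eq_smul_basisVec, ← hσ.apply_axis]
  exact hs

lemma mfderiv_chart_frame (hσ : IsFermiCoordinates h γ e U σ) {φ : N → Coord d} {t : ℝ}
    (hφ : MDifferentiableAt (𝓡 (d + 1)) (𝓡 (d + 1)) φ (γ t))
    (hφσ : φ ∘ σ =ᶠ[𝓝 (axis t)] id) (j : Fin d) :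
    mfderiv (𝓡 (d + 1)) (𝓡 (d + 1)) φ (γ t) (e j.succ t) = transversal (Pi.single j 1) := by
  set w : Coord d := transversal (Pi.single j 1)
  let c : ℝ → N := fun s => σ (axis t + s • w)
  have hline : Filter.Tendsto (fun s : ℝ => axis t + s • w) (𝓝 0) (𝓝 (axis t)) := by
    simpa using (hasDerivAt_line (axis t) w 0).continuousAt.tendsto
  have hc0 : c 0 = γ t := by simp [c, hσ.apply_axis]
  have hc : MDifferentiableAt 𝓘(ℝ, ℝ) (𝓡 (d + 1)) c 0 :=
    ((hσ.geodesic t (Pi.single j 1)).1.contMDiffAt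
      (hline (hσ.isOpen.mem_nhds (hσ.axis_mem t)))).mdifferentiableAt (by simp)
  have sum_single : ∑ k : Fin d, (Pi.single j 1 : Fin d → ℝ) k • e k.succ t = e j.succ t := by
    simp [Pi.single_apply]
  have initial : (⟨c 0, velocity c 0⟩ : TangentBundle (𝓡 (d + 1)) N) = ⟨γ t, e j.succ t⟩ :=
    sum_single ▸ hσ.initial t (Pi.single j 1)
  have mfderiv_initial : mfderiv (𝓡 (d + 1)) (𝓡 (d + 1)) φ (c 0) (velocity c 0)
      = mfderiv (𝓡 (d + 1)) (𝓡 (d + 1)) φ (γ t) (e j.succ t) :=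
    congrArg (fun p : TangentBundle (𝓡 (d + 1)) N =>
      (mfderiv (𝓡 (d + 1)) (𝓡 (d + 1)) φ p.1 p.2 : Coord d)) initial
  have hφc : φ ∘ c =ᶠ[𝓝 0] fun s => axis t + s • w := hφσ.comp_tendsto hline
  rw [← mfderiv_initial, mfderiv_velocity (hc0 ▸ hφ) hc, hφc.deriv_eq,
    (hasDerivAt_line _ _ _).deriv]

lemma christoffel_zero_succ_axis (hσ : IsFermiCoordinates h γ e U σ) {j : Fin d}
    (hpar : IsParallelAlong h γ (e j.succ)) (i : Fin (d + 1)) (t : ℝ) :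
    christoffel (metricComp h σ) i 0 j.succ (axis t) = 0 := by
  obtain ⟨φ, hφ, hs, hφγ, hφσ, hg⟩ := hσ.exists_chart_axis t
  let v : ℝ → Coord d := fun s => mfderiv (𝓡 (d + 1)) (𝓡 (d + 1)) φ (γ s) (e j.succ s)
  have frame_const : v =ᶠ[𝓝 t] fun _ => transversal (Pi.single j 1) := by
    filter_upwards [hσ.continuous_curve.continuousAt (φ.open_source.mem_nhds hs),
      (hasDerivAt_axis t).continuousAt.eventually hφσ.eventuallyEq_nhds] with s hsφ hφσ_s
    exact hσ.mfderiv_chart_frame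
      ((contMDiffAt_of_mem_maximalAtlas hφ hsφ).mdifferentiableAt (by simp)) hφσ_s j
  have coord_const : (fun s => v s i) =ᶠ[𝓝 t] fun _ => (transversal (Pi.single j 1) : Coord d) i :=
    frame_const.fun_comp (· i)
  have parallel : -∑ k, ∑ l, christoffel (metricComp h φ.symm) i k l (φ (γ t))
      * deriv (fun s => φ (γ s) k) t * v t l = 0 :=
    (hpar φ hφ t hs i).unique ((hasDerivAt_const t _).congr_of_eventuallyEq coord_const)
  have Γ_eq (k l) := (christoffel_congr hg i k l).eq_of_nhds
  simp only [frame_const.eq_of_nhds, hσ.deriv_coord_chart_curve hφσ, hφγ, Γ_eq] at parallel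
  simpa [Fin.sum_univ_succ, basisVec, Pi.single_apply, transversal_zero_apply,
    transversal_succ_apply] using parallel

lemma christoffel_axis (hσ : IsFermiCoordinates h γ e U σ) (hγ : IsGeodesicOn h γ Set.univ)
    (hpar : ∀ j : Fin d, IsParallelAlong h γ (e j.succ)) (i j k : Fin (d + 1)) (t : ℝ) :
    christoffel (metricComp h σ) i j k (axis t) = 0 := by
  cases j using Fin.cases with
  | zero =>
    cases k using Fin.cases with
    | zero => exact hσ.christoffel_zero_zero_axis hγ i t
    | succ b => exact hσ.christoffel_zero_succ_axis (hpar b) i t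
  | succ a =>
    cases k using Fin.cases with
    | zero =>
      rw [christoffel_symm (isSymm_metricComp h σ)]
      exact hσ.christoffel_zero_succ_axis (hpar a) i t
    | succ b => exact hσ.christoffel_succ_succ_axis i a b t

lemma covDeriv_iterCovRiemann_axis (hσ : IsFermiCoordinates h γ e U σ)
    (hsymm : IsLocallySymmetricAlong h γ) (n : ℕ) (i : Fin (d + 1))
    (J : Fin (3 + n) → Fin (d + 1)) (t : ℝ) :
    covDeriv (metricComp h σ) (iterCovRiemann (metricComp h σ) n) i
      (Fin.cons 0 J : Fin (3 + n + 1) → Fin (d + 1)) (axis t) = 0 := by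
  obtain ⟨φ, hφ, hs, hφγ, hφσ, hg⟩ := hσ.exists_chart_axis t
  have covDeriv_eq (J) := (covDeriv_congr hg (iterCovRiemann_congr hg n) i J).eq_of_nhds
  have := hsymm n t φ hφ hs i J
  simp only [hσ.deriv_coord_chart_curve hφσ, hφγ, covDeriv_eq] at this
  simpa [basisVec, Pi.single_apply] using this

end IsFermiCoordinates

end FermiCoord

end

open FermiCoord in
theorem mainTheorem4_general {d : ℕ} {N : Type*} [TopologicalSpace N]
    [ChartedSpace (Coord d) N] [IsManifold (𝓡 (d + 1)) ∞ N] (h : Metric d N)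
    (γ : ℝ → N) (hγ : IsGeodesicOn h γ Set.univ) (hsymm : IsLocallySymmetricAlong h γ)
    (e : Fin (d + 1) → (t : ℝ) → TangentSpace (𝓡 (d + 1)) (γ t))
    (hpar : ∀ j : Fin d, IsParallelAlong h γ (e j.succ))
    (U : Set (Coord d)) (σ : Coord d → N) (hσ : IsFermiCoordinates h γ e U σ) :
    (∀ i j k, ContDiffOn ℝ ∞ (christoffel (metricComp h σ) k i j) U) ∧
    (∀ i j k l, ContDiffOn ℝ ∞ (riemann (metricComp h σ) i j k l) U) ∧
    (∀ (I : List (Fin (d + 1))) (i j k : Fin (d + 1)) (t : ℝ),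
      pd 0 (pdIter I (christoffel (metricComp h σ) k i j)) (axis t) = 0) ∧
    (∀ (I : List (Fin (d + 1))) (i j k l : Fin (d + 1)) (t : ℝ),
      pd 0 (pdIter I (riemann (metricComp h σ) i j k l)) (axis t) = 0) ∧
    (∀ (I : List (Fin (d + 1))) (i j k : Fin (d + 1)) (s t : ℝ),
      pdIter I (christoffel (metricComp h σ) k i j) (axis s)
        = pdIter I (christoffel (metricComp h σ) k i j) (axis t)) ∧
    (∀ (I : List (Fin (d + 1))) (i j k l : Fin (d + 1)) (s t : ℝ),
      pdIter I (riemann (metricComp h σ) i j k l) (axis s)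
        = pdIter I (riemann (metricComp h σ) i j k l) (axis t)) := by
  have smooth_Γ {x} (hx : x ∈ U) := hσ.contDiffAt_christoffel hx
  have axisConst := isAxisConst_christoffel_and_iterCovRiemann (isSymm_metricComp h σ)
    (fun i j k t => smooth_Γ (hσ.axis_mem t) i j k) (hσ.christoffel_axis hγ hpar)
    hσ.radial_radial_christoffel (hσ.covDeriv_iterCovRiemann_axis hsymm)
  have Γ_axisConst (m i j k) : IsAxisConst m (christoffel (metricComp h σ) k i j) :=
    (axisConst m).1 k i j
  have R_axisConst (m i j k l) : IsAxisConst m (riemann (metricComp h σ) i j k l) :=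
    (axisConst m).2 0 i ![j, k, l]
  exact ⟨fun i j k x hx => (smooth_Γ hx k i j).contDiffWithinAt,
    fun i j k l x hx => (contDiffAt_riemann (smooth_Γ hx) i j k l).contDiffWithinAt,
    fun I i j k => (Γ_axisConst I.length i j k).pd_zero_pdIter le_rfl,
    fun I i j k l => (R_axisConst I.length i j k l).pd_zero_pdIter le_rfl,
    fun I i j k => (Γ_axisConst I.length i j k).pdIter_eq I le_rfl,
    fun I i j k l => (R_axisConst I.length i j k l).pdIter_eq I le_rfl⟩

theorem mainTheorem4 {d : ℕ} {N : Type*} [TopologicalSpace N]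
    [ChartedSpace (FermiCoord.Coord d) N] [IsManifold (𝓡 (d + 1)) ∞ N]
    (h : FermiCoord.Metric d N)
    (γ : ℝ → N) (hγ : FermiCoord.IsGeodesicOn h γ Set.univ)
    (hsymm : FermiCoord.IsLocallySymmetricAlong h γ)
    (e : Fin (d + 1) → (t : ℝ) → TangentSpace (𝓡 (d + 1)) (γ t))
    (he : FermiCoord.IsFermiFrame h γ e)
    (U : Set (FermiCoord.Coord d)) (σ : FermiCoord.Coord d → N)
    (hσ : FermiCoord.IsFermiCoordinates h γ e U σ) :
    -- the Christoffel symbols and the curvature components are smooth on the coordinate domain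
    (∀ i j k, ContDiffOn ℝ ∞ (FermiCoord.christoffel (FermiCoord.metricComp h σ) k i j) U) ∧
    (∀ i j k l, ContDiffOn ℝ ∞ (FermiCoord.riemann (FermiCoord.metricComp h σ) i j k l) U) ∧
    -- the derivatives `∂_1 ∂^I` of them vanish along `γ`
    (∀ (I : List (Fin (d + 1))) (i j k : Fin (d + 1)) (t : ℝ),
      FermiCoord.pd 0 (FermiCoord.pdIter I
        (FermiCoord.christoffel (FermiCoord.metricComp h σ) k i j)) (FermiCoord.axis t) = 0) ∧
    (∀ (I : List (Fin (d + 1))) (i j k l : Fin (d + 1)) (t : ℝ),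
      FermiCoord.pd 0 (FermiCoord.pdIter I
        (FermiCoord.riemann (FermiCoord.metricComp h σ) i j k l)) (FermiCoord.axis t) = 0) ∧
    -- all their Taylor coefficients are constant along `γ`
    (∀ (I : List (Fin (d + 1))) (i j k : Fin (d + 1)) (s t : ℝ),
      FermiCoord.pdIter I (FermiCoord.christoffel (FermiCoord.metricComp h σ) k i j)
          (FermiCoord.axis s)
        = FermiCoord.pdIter I (FermiCoord.christoffel (FermiCoord.metricComp h σ) k i j)
          (FermiCoord.axis t)) ∧
    (∀ (I : List (Fin (d + 1))) (i j k l : Fin (d + 1)) (s t : ℝ),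
      FermiCoord.pdIter I (FermiCoord.riemann (FermiCoord.metricComp h σ) i j k l)
          (FermiCoord.axis s)
        = FermiCoord.pdIter I (FermiCoord.riemann (FermiCoord.metricComp h σ) i j k l)
          (FermiCoord.axis t)) :=
  mainTheorem4_general h γ hγ hsymm e he.parallel U σ hσ
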